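/- Let $G$ be a finite simple bipartite cubic plane graph (not necessarily connected). Suppose that its faces are colored red, blue and green so that any two different faces that share an edge have different colors, and that the size of every blue face and of every green face is divisible by $4$ (the red faces may have any size). Here the size of a face is the total length of its boundary, an edge with the face on both sides being counted twice. Then $G$ has a distance-two six-coloring: there is a map $c\colon V(G)\to\{1,\dots,6\}$ such that, for every vertex $v$, the four colors of $v$ and of its three neighbors are all distinct. -/

import Mathlib

/-- A rotation system on a graph `G`, together with an assignment of faces to the sides of the edges.
A dart is an edge with a direction; a dart also stands for the side of its edge that lies to its
left, so that an edge has two sides, `d` and `d.symm`. -/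
structure FacedMap {V : Type*} (G : SimpleGraph V) (F : Type*) where
  /-- The next dart in the clockwise cyclic order of the darts that leave a vertex. -/
  rot : Equiv.Perm G.Dart
  rot_fst : ∀ d, (rot d).fst = d.fst
  /-- The darts that leave a given vertex form one cycle of the rotation. -/
  rot_sameCycle : ∀ d d' : G.Dart, d.fst = d'.fst → rot.SameCycle d d'
  /-- The face to the left of a dart. -/
  face : G.Dart → F
  /-- A face is kept when its boundary is traversed: having walked along `d`, one goes on with the
  dart that follows the reversal of `d` in the rotation at the end of `d`. The boundary of a face is
  thus a union of orbits of `d ↦ rot d.symm`; it is one orbit if `G` is connected and has an edge,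
  and may consist of several orbits if `G` is disconnected. -/
  face_rot_symm : ∀ d, face (rot d.symm) = face d

namespace FacedMap

variable {V F : Type*} {G : SimpleGraph V}

/-- The adjacency graph of the faces: two different faces are adjacent if some edge has one of
them on one side and the other one on the other side. -/
def dual (M : FacedMap G F) : SimpleGraph F :=
  SimpleGraph.fromRel fun f g => ∃ d : G.Dart, M.face d = f ∧ M.face d.symm = g

/-- The size of a face: the length of its boundary, that is, the number of edges on it, where an
edge with the face on both sides counts twice. -/
noncomputable def faceSize (M : FacedMap G F) (f : F) : ℕ :=
  Nat.card {d : G.Dart // M.face d = f}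

end FacedMap

/-- An embedding of a finite graph `G`, connected or not, in the plane (equivalently in the
sphere), with set of faces `F`, given combinatorially. The surface is connected, so one can
get from any face to any other by crossing edges; and Euler's formula
`|V| - |E| + |F| = 1 + (number of connected components)` holds.

For connected `G` with an edge these are precisely the rotation systems of genus zero with their
facial orbits as faces. In general the two conditions say that every component has genus zero and
that the components and the faces, joined by the facial orbits, form a tree. -/
structure PlaneEmbedding {V : Type*} (G : SimpleGraph V) (F : Type*) extends FacedMap G F where
  dual_connected : toFacedMap.dual.Connected
  euler : Nat.card V + Nat.card F = Nat.card G.edgeSet + 1 + Nat.card G.ConnectedComponent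

/-- The colors of the faces. -/
inductive FaceColor
  | red
  | blue
  | green

/-- A distance-two `r`-coloring of `G`: for every vertex `v`, the colors of `v` and of all the
neighbors of `v` are all distinct. -/
def IsDistanceTwoColoring {V : Type*} (G : SimpleGraph V) (r : ℕ) (c : V → Fin r) : Prop :=
  ∀ v : V, Set.InjOn c (insert v (G.neighborSet v))

open Equiv.Perm Function Module

/-! The six colors are pairs `(c, t)` with three and two values. The three faces at a vertex have
the three colors. Let `n` move a vertex one step along its red face, and let `μ` cross its
blue-green edge; the neighbors of `v` are `n v`, `n⁻¹ v` and `μ v`. It suffices that `t` changes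
under `n` but not under `μ`, and that `c` separates `v` from `μ v` and from `n (n v)`.

For `t`: edges to red and blue-green edges alternate along a blue or green face, so divisibility by
4 makes the number of blue-green edges even on every face. By `exists_potential` some `s` modulo two
changes exactly along these edges; `t` is `s` plus the bipartition.

For `c`: the cycles of `σ = n²` and the matching `μ` form a cubic multigraph to be three-colored. As
`s` is constant on the cycles and changes under `μ`, the matching joins different cycles, and the
Brooks-type `exists_three_coloring` applies. -/

theorem exists_seq_avoiding (φ : ℕ → Fin 3) (a : Fin 3) :
    ∃ h : ℕ → Fin 3, h 0 = a ∧ ∀ n, h (n + 1) ≠ h n ∧ h (n + 1) ≠ φ (n + 1) := by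
  have third : ∀ x y : Fin 3, ∃ z, z ≠ x ∧ z ≠ y := by decide
  choose t ht using third
  exact ⟨fun n => Nat.rec a (fun n x => t x (φ (n + 1))) n, rfl, fun n => ht _ _⟩

/-! ### Three-colorings of one cycle with forbidden colors -/

namespace Equiv.Perm

variable {V : Type*} (σ : Equiv.Perm V)

theorem minimalPeriod_pos [Finite V] (x : V) : 0 < minimalPeriod σ x :=
  minimalPeriod_pos_of_mem_periodicPts (σ.injective.mem_periodicPts x)

theorem SameCycle.exists_iterate_eq [Finite V] {σ : Equiv.Perm V} {x v : V} (h : σ.SameCycle x v) :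
    ∃ i < minimalPeriod σ x, σ^[i] x = v := by
  obtain ⟨i, hi⟩ := h.exists_nat_pow_eq
  refine ⟨i % minimalPeriod σ x, Nat.mod_lt _ (minimalPeriod_pos σ x), ?_⟩
  rw [iterate_mod_minimalPeriod_eq, Equiv.Perm.iterate_eq_pow, hi]

theorem exists_lift_iterate {α : Type*} (x : V) (h : ℕ → α) :
    ∃ g : V → α, ∀ i < minimalPeriod σ x, g (σ^[i] x) = h i := by
  refine ⟨fun v => h (invFunOn (fun i => σ^[i] x) (Set.Iio (minimalPeriod σ x)) v), fun i hi => ?_⟩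
  exact congrArg h ((iterate_injOn_Iio_minimalPeriod (f := σ) (x := x)).leftInvOn_invFunOn hi)

theorem two_le_minimalPeriod [Finite V] {x : V} (hx : σ x ≠ x) : 2 ≤ minimalPeriod σ x := by
  have h0 := minimalPeriod_pos σ x
  have h1 : minimalPeriod σ x ≠ 1 := fun h => hx (minimalPeriod_eq_one_iff_isFixedPt.1 h)
  omega

/-- Reduction of a proper coloring of a cycle to a coloring of its vertices numbered in order. -/
theorem exists_coloring_of_seq [Finite V] {x : V} (h : ℕ → Fin 3)
    (hsucc : ∀ i, i + 1 < minimalPeriod σ x → h (i + 1) ≠ h i)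
    (hlast : h 0 ≠ h (minimalPeriod σ x - 1)) :
    ∃ g : V → Fin 3, (∀ i < minimalPeriod σ x, g (σ^[i] x) = h i) ∧
      ∀ v, σ.SameCycle x v → g (σ v) ≠ g v := by
  obtain ⟨g, hg⟩ := exists_lift_iterate σ x h
  refine ⟨g, hg, fun v hv => ?_⟩
  obtain ⟨i, hi, rfl⟩ := hv.exists_iterate_eq
  rw [← iterate_succ_apply' σ, hg i hi]
  rcases Nat.lt_or_ge (i + 1) (minimalPeriod σ x) with h1 | h1
  · rw [hg _ h1]
    exact hsucc i h1
  · have h2 : i + 1 = minimalPeriod σ x := by omega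
    have h3 := hg 0 (by omega)
    rw [iterate_zero, id] at h3
    rw [Nat.succ_eq_add_one, h2, iterate_minimalPeriod, h3]
    rwa [← h2, Nat.add_sub_cancel] at hlast

/-- A cycle can be properly three-colored if one color is forbidden at every vertex but one. -/
theorem exists_coloring_avoiding_except [Finite V] (φ : V → Fin 3) {x : V} (hx : σ x ≠ x) :
    ∃ g : V → Fin 3, ∀ v, σ.SameCycle x v → g (σ v) ≠ g v ∧ (v ≠ x → g v ≠ φ v) := by
  have hk := two_le_minimalPeriod σ hx
  obtain ⟨h, -, hh⟩ := exists_seq_avoiding (fun i => φ (σ^[i] x)) 0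
  have third : ∀ x y : Fin 3, ∃ z, z ≠ x ∧ z ≠ y := by decide
  -- The free vertex `x` is colored last and only has to differ from its two neighbors on the cycle.
  obtain ⟨z, hz1, hz2⟩ := third (h 1) (h (minimalPeriod σ x - 1))
  obtain ⟨g, hg, hgσ⟩ := exists_coloring_of_seq σ (x := x) (Function.update h 0 z)
    (by
      rintro (_ | i) hi
      · simpa using hz1.symm
      · simpa using (hh (i + 1)).1)
    (by
      rw [update_self, update_of_ne (by omega)]
      exact hz2)
  refine ⟨g, fun v hv => ⟨hgσ v hv, fun hvx => ?_⟩⟩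
  obtain ⟨i, hi, rfl⟩ := hv.exists_iterate_eq
  rw [hg i hi]
  rcases i with _ | i
  · exact absurd rfl hvx
  · simpa using (hh i).2

/-- A cycle can be properly three-colored if one color is forbidden at every vertex, and not the
same one everywhere. -/
theorem exists_coloring_avoiding [Finite V] (φ : V → Fin 3) {u v : V} (hu : σ u ≠ u)
    (huv : σ.SameCycle u v) (hφ : φ u ≠ φ v) :
    ∃ g : V → Fin 3, ∀ w, σ.SameCycle u w → g (σ w) ≠ g w ∧ g w ≠ φ w := by
  obtain ⟨x, hux, hx⟩ : ∃ x, σ.SameCycle u x ∧ φ (σ x) ≠ φ x := by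
    by_contra! hcon
    have key : ∀ i : ℕ, φ (σ^[i] u) = φ u := by
      intro i
      induction i with
      | zero => rfl
      | succ i ih =>
        rw [iterate_succ_apply', hcon _ ⟨i, by simp [Equiv.Perm.iterate_eq_pow]⟩, ih]
    obtain ⟨i, -, rfl⟩ := huv.exists_iterate_eq
    exact hφ (key i).symm
  have hy : σ.SameCycle u (σ x) := hux.apply_right
  have hyy : σ (σ x) ≠ σ x := by
    obtain ⟨i, -, hi⟩ := hy.exists_iterate_eq
    rw [← hi, ← iterate_succ_apply' σ, iterate_succ_apply]
    exact fun h => hu (σ.injective.iterate i h)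
  have hk := two_le_minimalPeriod σ hyy
  have hlast : σ^[minimalPeriod σ (σ x) - 1] (σ x) = x := by
    apply σ.injective
    rw [← iterate_succ_apply' σ, Nat.succ_eq_add_one, Nat.sub_add_cancel (by omega),
      iterate_minimalPeriod]
  -- The greedy coloring starts at `σ x` with the color forbidden at `x`. The last vertex is `x`,
  -- which avoids that color, so the cycle closes up.
  obtain ⟨h, h0, hh⟩ := exists_seq_avoiding (fun i => φ (σ^[i] (σ x))) (φ x)
  obtain ⟨g, hg, hgσ⟩ := exists_coloring_of_seq σ (x := σ x) h (fun i _ => (hh i).1)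
    (by
      have := (hh (minimalPeriod σ (σ x) - 2)).2
      rw [show minimalPeriod σ (σ x) - 2 + 1 = minimalPeriod σ (σ x) - 1 by omega] at this
      simp only [hlast] at this
      rw [h0]
      exact this.symm)
  refine ⟨g, fun w hw => ?_⟩
  have hw' := hy.symm.trans hw
  refine ⟨hgσ w hw', ?_⟩
  obtain ⟨i, hi, rfl⟩ := hw'.exists_iterate_eq
  rw [hg i hi]
  rcases i with _ | i
  · rw [h0]
    exact hx.symm
  · exact (hh i).2

/-! ### Brooks' theorem for cycles joined by a matching -/

/-- The cycle of `σ` through a point. -/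
def cyc (v : V) : Quotient (SameCycle.setoid σ) := Quotient.mk _ v

theorem cyc_eq {u v : V} : σ.cyc u = σ.cyc v ↔ σ.SameCycle u v := Quotient.eq

theorem cyc_apply (v : V) : σ.cyc (σ v) = σ.cyc v := (cyc_eq σ).2 (SameCycle.refl _ _).apply_left

/-- `c` is a proper coloring of the cycles in `S` and of the edges `v`, `μ v` among them. -/
def IsProperOn (μ : V → V) (S : Finset (Quotient (SameCycle.setoid σ))) (c : V → Fin 3) : Prop :=
  ∀ v, σ.cyc v ∈ S → c (σ v) ≠ c v ∧ (σ.cyc (μ v) ∈ S → c (μ v) ≠ c v)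

variable {σ} {μ : V → V}

open Classical in
theorem IsProperOn.insert {S : Finset (Quotient (SameCycle.setoid σ))} {c g : V → Fin 3}
    (hc : IsProperOn σ μ S c) (hμ : Involutive μ) (hloop : ∀ v, σ.cyc (μ v) ≠ σ.cyc v)
    (D : Quotient (SameCycle.setoid σ))
    (hg : ∀ v, σ.cyc v = D → g (σ v) ≠ g v ∧ (σ.cyc (μ v) ∈ S → g v ≠ c (μ v))) :
    IsProperOn σ μ (insert D S) (fun v => if σ.cyc v = D then g v else c v) := by
  intro v hv
  have hv' := hloop v
  rw [Finset.mem_insert] at hv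
  simp only [cyc_apply, Finset.mem_insert]
  by_cases h : σ.cyc v = D
  · have h2 : σ.cyc (μ v) ≠ D := by rwa [h] at hv'
    simp only [h, h2, if_true, if_false, false_or]
    exact ⟨(hg v h).1, fun h3 => ((hg v h).2 h3).symm⟩
  · have hvS := hv.resolve_left h
    simp only [h, if_false]
    refine ⟨(hc v hvS).1, ?_⟩
    by_cases h2 : σ.cyc (μ v) = D
    · simp only [h2, if_true]
      intro _
      have := (hg (μ v) h2).2
      rw [hμ v] at this
      exact this hvS
    · simp only [h2, if_false, false_or]
      exact (hc v hvS).2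

theorem IsProperOn.mono {S T : Finset (Quotient (SameCycle.setoid σ))} {c : V → Fin 3}
    (hc : IsProperOn σ μ S c) (h : T ⊆ S) : IsProperOn σ μ T c :=
  fun v hv => ⟨(hc v (h hv)).1, fun h2 => (hc v (h hv)).2 (h h2)⟩

open Classical in
/-- If the cycle through `e` is uncolored in a coloring with the largest number of colored cycles,
then all partners of its vertices are colored, with the same color. -/
theorem IsProperOn.partners [Finite V] {S : Finset (Quotient (SameCycle.setoid σ))} {c : V → Fin 3}
    (hc : IsProperOn σ μ S c) (hμ : Involutive μ) (hloop : ∀ v, σ.cyc (μ v) ≠ σ.cyc v)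
    (hσ : ∀ v, σ v ≠ v)
    (hmax : ∀ T c', IsProperOn σ μ T c' → T.card ≤ S.card) {e : V} (he : σ.cyc e ∉ S) :
    (∀ v, σ.cyc v = σ.cyc e → σ.cyc (μ v) ∈ S) ∧
      ∀ v, σ.cyc v = σ.cyc e → c (μ v) = c (μ e) := by
  have noext : ∀ g : V → Fin 3, ¬ ∀ v, σ.cyc v = σ.cyc e →
      g (σ v) ≠ g v ∧ (σ.cyc (μ v) ∈ S → g v ≠ c (μ v)) := by
    intro g hg
    have := hmax _ _ (hc.insert hμ hloop _ hg)
    rw [Finset.card_insert_of_notMem he] at this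
    omega
  constructor
  · intro x hx
    by_contra hxS
    obtain ⟨g, hg⟩ := exists_coloring_avoiding_except σ (fun v => c (μ v)) (hσ x)
    refine noext g fun v hv => ?_
    have := hg v ((cyc_eq σ).1 (hx.trans hv.symm))
    refine ⟨this.1, fun h => this.2 ?_⟩
    rintro rfl
    exact hxS h
  · intro v hv
    by_contra hne
    obtain ⟨g, hg⟩ := exists_coloring_avoiding σ (fun v => c (μ v)) (hσ e)
      ((cyc_eq σ).1 hv.symm) (Ne.symm hne)
    refine noext g fun w hw => ?_
    have := hg w ((cyc_eq σ).1 hw.symm)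
    exact ⟨this.1, fun _ => this.2⟩

open Classical in
/-- Brooks' theorem for a cubic graph made of the cycles of `σ` and a perfect matching `μ` that
joins different cycles. -/
theorem exists_three_coloring [Finite V] (hμ : Involutive μ) (hloop : ∀ v, ¬ σ.SameCycle (μ v) v)
    (hσ : ∀ v, σ v ≠ v) :
    ∃ c : V → Fin 3, ∀ v, c (σ v) ≠ c v ∧ c (μ v) ≠ c v := by
  replace hloop : ∀ v, σ.cyc (μ v) ≠ σ.cyc v := fun v h => hloop v ((cyc_eq σ).1 h)
  have := Fintype.ofFinite (Quotient (SameCycle.setoid σ))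
  obtain ⟨S, ⟨c, hc⟩, hmax⟩ : ∃ S : Finset (Quotient (SameCycle.setoid σ)),
      (∃ c, IsProperOn σ μ S c) ∧ ∀ T c', IsProperOn σ μ T c' → T.card ≤ S.card := by
    obtain ⟨S, hS, hmax⟩ := (Finset.univ.filter fun S : Finset (Quotient (SameCycle.setoid σ)) =>
      ∃ c, IsProperOn σ μ S c).exists_max_image Finset.card
        ⟨∅, Finset.mem_filter.2 ⟨Finset.mem_univ _, fun _ => 0, by simp [IsProperOn]⟩⟩
    simp only [Finset.mem_filter, Finset.mem_univ, true_and] at hS hmax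
    exact ⟨S, hS, fun T c' h => hmax T ⟨c', h⟩⟩
  by_cases hS : ∀ v, σ.cyc v ∈ S
  · exact ⟨c, fun v => ⟨(hc v (hS _)).1, (hc v (hS _)).2 (hS _)⟩⟩
  exfalso
  push Not at hS
  obtain ⟨e₀, he₀⟩ := hS
  -- The uncolored cycle is moved along a walk; `W` is the set of the cycles it has left.
  have walk : ∀ n : ℕ, ∃ (T : Finset (Quotient (SameCycle.setoid σ))) (c : V → Fin 3)
      (W : Finset (Quotient (SameCycle.setoid σ))) (e : V),
      T.card = S.card ∧ IsProperOn σ μ T c ∧ σ.cyc e ∉ T ∧ W ⊆ T ∧ W.card = n ∧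
      -- The color `c (μ e)` stays the same along the walk. Each cycle in `W` has it at one vertex
      -- only, the exit, whose partner is the entry of the next cycle.
      ∀ x, σ.cyc x ∈ W → c x = c (μ e) → σ.cyc (μ x) ∈ W ∨ μ x = e := by
    intro n
    induction n with
    | zero => exact ⟨S, c, ∅, e₀, rfl, hc, he₀, by simp, rfl, by simp⟩
    | succ n ih =>
      obtain ⟨T, c, W, e, hT, hc, he, hWT, hWn, hW⟩ := ih
      have hmaxT : ∀ T' c', IsProperOn σ μ T' c' → T'.card ≤ T.card := by rwa [hT]
      obtain ⟨hcol, hconst⟩ := hc.partners hμ hloop hσ hmaxT he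
      obtain ⟨g, hg⟩ := exists_coloring_avoiding_except σ (fun v => c (μ v)) (hσ (σ e))
      have hcyce : σ.cyc (σ e) = σ.cyc e := cyc_apply σ e
      have hz := hcol (σ e) hcyce
      have hzD : σ.cyc (μ (σ e)) ≠ σ.cyc e := hcyce ▸ hloop (σ e)
      have hg1 : ∀ v, σ.cyc v = σ.cyc e → g (σ v) ≠ g v := fun v hv =>
        (hg v ((cyc_eq σ).1 (hcyce.trans hv.symm))).1
      have hg2 : ∀ v, σ.cyc v = σ.cyc e → v ≠ σ e → g v ≠ c (μ e) := fun v hv hne =>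
        hconst v hv ▸ (hg v ((cyc_eq σ).1 (hcyce.trans hv.symm))).2 hne
      -- Otherwise the cycle could be added to `T`, against maximality. So the only clash is at the
      -- exit `σ e`, and it is removed by uncoloring the cycle of `μ (σ e)`.
      have hge : g (σ e) = c (μ e) := by
        by_contra hne
        have := hmaxT _ _ (hc.insert hμ hloop (σ.cyc e) (g := g) fun v hv => ⟨hg1 v hv, fun _ => by
          rw [hconst v hv]
          by_cases hve : v = σ e
          · rwa [hve]
          · exact hg2 v hv hve⟩)
        rw [Finset.card_insert_of_notMem he] at this
        omega
      have hproper := (hc.mono (Finset.erase_subset (σ.cyc (μ (σ e))) T)).insert hμ hloop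
        (σ.cyc e) (g := g) fun v hv => ⟨hg1 v hv, fun h => by
          rw [hconst v hv]
          refine hg2 v hv ?_
          rintro rfl
          simp at h⟩
      -- The walk never returns: `μ (σ e)` has the color of the walk, so on a cycle of `W` the
      -- invariant would put its partner `σ e` on a colored cycle or make it equal to `e`.
      have hzW : σ.cyc (μ (σ e)) ∉ W := by
        intro h
        rcases hW _ h (hconst _ hcyce) with h1 | h1
        · rw [hμ, hcyce] at h1
          exact he (hWT h1)
        · rw [hμ] at h1
          exact hσ e h1
      refine ⟨_, _, insert (σ.cyc e) W, μ (σ e), ?_, hproper, ?_, ?_, ?_, ?_⟩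
      · rw [Finset.card_insert_of_notMem (fun h => he (Finset.mem_of_mem_erase h)),
          Finset.card_erase_add_one hz, hT]
      · simp [hzD]
      · exact Finset.insert_subset_insert _ fun w hw =>
          Finset.mem_erase.2 ⟨fun h => hzW (h ▸ hw), hWT hw⟩
      · rw [Finset.card_insert_of_notMem (fun h => he (hWT h)), hWn]
      · intro x hx hcx
        rw [hμ, if_pos hcyce, hge] at hcx
        by_cases hxe : σ.cyc x = σ.cyc e
        · rw [if_pos hxe] at hcx
          right
          by_contra hne
          exact hg2 x hxe (fun h => hne (h ▸ rfl)) hcx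
        · rw [if_neg hxe] at hcx
          left
          rcases hW x ((Finset.mem_insert.1 hx).resolve_left hxe) hcx with h | h
          · exact Finset.mem_insert_of_mem h
          · rw [h]
            exact Finset.mem_insert_self _ _
  obtain ⟨T, c, W, e, -, -, -, -, hW, -⟩ := walk (Fintype.card (Quotient (SameCycle.setoid σ)) + 1)
  have := W.card_le_univ
  omega

end Equiv.Perm

/-! ### Cohomology modulo two of a plane graph -/

open Classical in
theorem FacedMap.sum_face_rot_symm {V F : Type*} {G : SimpleGraph V} [Fintype G.Dart]
    (M : FacedMap G F) {A : Type*} [AddCommMonoid A] (f : F) (x : G.Dart → A) :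
    ∑ d with M.face d = f, x (M.rot d.symm) = ∑ d with M.face d = f, x d := by
  refine Finset.sum_bij (fun d _ => M.rot d.symm) ?_ ?_ ?_ fun _ _ => rfl
  · intro d hd
    simpa [M.face_rot_symm] using hd
  · intro a _ b _ h
    exact SimpleGraph.Dart.symm_involutive.injective (M.rot.injective h)
  · intro b hb
    refine ⟨(M.rot.symm b).symm, ?_, by simp⟩
    have := M.face_rot_symm (M.rot.symm b).symm
    simp only [SimpleGraph.Dart.symm_symm, Equiv.apply_symm_apply] at this
    simpa [← this] using hb

namespace PlaneEmbedding

variable {V F : Type*} {G : SimpleGraph V}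

/-- The coboundary of a function on the vertices, modulo two. -/
def vertexCoboundary (G : SimpleGraph V) : (V → ZMod 2) →ₗ[ZMod 2] (G.edgeSet → ZMod 2) where
  toFun s e := Sym2.lift ⟨fun u v => s u + s v, fun _ _ => add_comm _ _⟩ e.1
  map_add' s t := by
    ext ⟨e, he⟩
    induction e with
    | _ u v => simp; ring
  map_smul' a s := by
    ext ⟨e, he⟩
    induction e with
    | _ u v => simp; ring

theorem vertexCoboundary_edge (s : V → ZMod 2) (d : G.Dart) :
    vertexCoboundary G s ⟨d.edge, d.edge_mem⟩ = s d.fst + s d.snd := rfl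

/-- A function in the kernel is constant on components, hence determined by its values at one
representative of each. -/
theorem finrank_ker_vertexCoboundary_le [Finite V] :
    finrank (ZMod 2) (LinearMap.ker (vertexCoboundary G)) ≤ Nat.card G.ConnectedComponent := by
  have := Fintype.ofFinite G.ConnectedComponent
  rw [Nat.card_eq_fintype_card, ← finrank_fintype_fun_eq_card (ZMod 2)]
  let ev : LinearMap.ker (vertexCoboundary G) →ₗ[ZMod 2] (G.ConnectedComponent → ZMod 2) :=
    (LinearMap.funLeft (ZMod 2) (ZMod 2) fun C : G.ConnectedComponent => C.out) ∘ₗ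
      Submodule.subtype _
  refine LinearMap.finrank_le_finrank_of_injective (f := ev) ?_
  rw [← LinearMap.ker_eq_bot, LinearMap.ker_eq_bot']
  rintro ⟨s, hs⟩ h
  rw [LinearMap.mem_ker] at hs
  have hadj : ∀ u v, G.Adj u v → s u = s v := by
    intro u v huv
    have := congrFun hs ⟨s(u, v), huv⟩
    exact CharTwo.add_eq_zero.1 this
  have hreach : ∀ u v, G.Reachable u v → s u = s v := by
    rintro u v ⟨p⟩
    induction p with
    | nil => rfl
    | cons h _ ih => exact (hadj _ _ h).trans ih
  ext v
  have h1 := congrFun h (G.connectedComponentMk v)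
  have h2 : G.Reachable v (G.connectedComponentMk v).out :=
    (SimpleGraph.ConnectedComponent.exact (Quot.out_eq (G.connectedComponentMk v))).symm
  exact (hreach _ _ h2).trans h1

theorem sum_dart_eq_sum_edge [Fintype G.Dart] [Fintype G.edgeSet] (o : G.edgeSet → G.Dart)
    (ho : ∀ e, (o e).edge = e) {A : Type*} [AddCommMonoid A] (g : G.Dart → A) :
    ∑ d, g d = ∑ e, (g (o e) + g (o e).symm) := by
  classical
  rw [← Finset.sum_fiberwise_of_maps_to (s := Finset.univ) (t := Finset.univ)
    (g := fun d : G.Dart => (⟨d.edge, d.edge_mem⟩ : G.edgeSet)) (fun _ _ => Finset.mem_univ _)]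
  refine Finset.sum_congr rfl fun e _ => ?_
  rw [← Finset.sum_pair (o e).symm_ne.symm]
  refine Finset.sum_congr ?_ fun _ _ => rfl
  ext d
  rw [Finset.mem_filter, Finset.mem_insert, Finset.mem_singleton, ← SimpleGraph.dart_edge_eq_iff,
    ho, Subtype.ext_iff]
  simp

open Classical in
/-- A plane graph has no cohomology modulo two: a function on the edges whose sum over the boundary
of every face vanishes is a coboundary. -/
theorem exists_potential [Finite V] [Finite F] [Fintype G.Dart] (P : PlaneEmbedding G F)
    (w : G.Dart → ZMod 2) (hsymm : ∀ d, w d.symm = w d)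
    (hface : ∀ f, ∑ d with P.face d = f, w d = 0) :
    ∃ s : V → ZMod 2, ∀ d : G.Dart, s d.fst + s d.snd = w d := by
  have := Fintype.ofFinite V
  have := Fintype.ofFinite F
  have := Fintype.ofFinite G.edgeSet
  have hsurj : ∀ e : G.edgeSet, ∃ d : G.Dart, d.edge = e := by
    rintro ⟨e, he⟩
    induction e with
    | _ u v => exact ⟨⟨(u, v), he⟩, rfl⟩
  choose o ho using hsurj
  -- Incidence of faces and edges; an edge with one face on both sides gets `1 + 1 = 0`.
  let M : Matrix F G.edgeSet (ZMod 2) := Matrix.of fun f e =>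
    (if P.face (o e) = f then 1 else 0) + (if P.face (o e).symm = f then 1 else 0)
  have hM : ∀ x : G.Dart → ZMod 2, (∀ d, x d.symm = x d) → ∀ f,
      M.mulVecLin (fun e => x (o e)) f = ∑ d with P.face d = f, x d := by
    intro x hx f
    rw [Finset.sum_filter, sum_dart_eq_sum_edge o ho, Matrix.mulVecLin_apply, Matrix.mulVec,
      dotProduct]
    refine Finset.sum_congr rfl fun e _ => ?_
    simp [M, hx, add_mul]
  have hcob : ∀ (s : V → ZMod 2), vertexCoboundary G s =
      fun e => s (o e).fst + s (o e).snd := by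
    intro s
    ext e
    exact congrArg (vertexCoboundary G s)
      (Subtype.ext (ho e).symm : e = ⟨(o e).edge, (o e).edge_mem⟩)
  have hle : LinearMap.range (vertexCoboundary G) ≤ LinearMap.ker M.mulVecLin := by
    rintro _ ⟨s, rfl⟩
    rw [LinearMap.mem_ker, hcob]
    ext f
    rw [hM (fun d => s d.fst + s d.snd) (fun d => add_comm _ _), Finset.sum_add_distrib]
    have hperm : ∑ d with P.face d = f, s d.snd = ∑ d with P.face d = f, s d.fst := by
      rw [← P.sum_face_rot_symm f fun d => s d.fst]
      refine Finset.sum_congr rfl fun d _ => ?_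
      rw [P.rot_fst]
      rfl
    rw [hperm]
    exact CharTwo.add_self_eq_zero _
  -- A function on the faces killed by the transpose agrees across every edge, so it is constant by
  -- connectedness of the dual.
  have hkerT : finrank (ZMod 2) (LinearMap.ker M.transpose.mulVecLin) ≤ 1 := by
    have := P.dual_connected.nonempty
    let f₀ : F := Classical.arbitrary F
    have hT : ∀ (h : F → ZMod 2) (e : G.edgeSet), M.transpose.mulVecLin h e =
        h (P.face (o e)) + h (P.face (o e).symm) := by
      intro h e
      rw [Matrix.mulVecLin_apply, Matrix.mulVec, dotProduct]
      simp [M, add_mul, Finset.sum_add_distrib]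
    rw [← finrank_self (ZMod 2)]
    refine LinearMap.finrank_le_finrank_of_injective
      (f := (LinearMap.proj f₀ : (F → ZMod 2) →ₗ[ZMod 2] ZMod 2) ∘ₗ Submodule.subtype _) ?_
    rw [← LinearMap.ker_eq_bot, LinearMap.ker_eq_bot']
    rintro ⟨h, hh⟩ h0
    rw [LinearMap.mem_ker] at hh
    have hd : ∀ d : G.Dart, h (P.face d) = h (P.face d.symm) := by
      intro d
      have h1 := congrFun hh ⟨d.edge, d.edge_mem⟩
      rw [hT] at h1
      have h2 := CharTwo.add_eq_zero.1 h1
      rcases (SimpleGraph.dart_edge_eq_iff _ _).1 (ho ⟨d.edge, d.edge_mem⟩) with h3 | h3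
      · rwa [h3] at h2
      · rw [h3, SimpleGraph.Dart.symm_symm] at h2
        exact h2.symm
    have hadj : ∀ f g, P.dual.Adj f g → h f = h g := by
      intro f g hfg
      rw [FacedMap.dual, SimpleGraph.fromRel_adj] at hfg
      obtain ⟨-, ⟨d, rfl, rfl⟩ | ⟨d, rfl, rfl⟩⟩ := hfg
      · exact hd d
      · exact (hd d).symm
    have hreach : ∀ f g, P.dual.Reachable f g → h f = h g := by
      rintro f g ⟨p⟩
      induction p with
      | nil => rfl
      | cons hfg _ ih => exact (hadj _ _ hfg).trans ih
    ext f
    exact (hreach f f₀ (P.dual_connected.preconnected f f₀)).trans h0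
  -- Since `M` has rank at least `|F| - 1`, its kernel has dimension at most `|E| - |F| + 1`. By
  -- Euler's formula this is `|V|` minus the number of components, a lower bound for the rank of the
  -- coboundary.
  have hrank : finrank (ZMod 2) (LinearMap.ker M.mulVecLin) ≤
      finrank (ZMod 2) (LinearMap.range (vertexCoboundary G)) := by
    have h1 := LinearMap.finrank_range_add_finrank_ker M.mulVecLin
    have h2 := LinearMap.finrank_range_add_finrank_ker M.transpose.mulVecLin
    have h3 := LinearMap.finrank_range_add_finrank_ker (vertexCoboundary G)
    have h4 := finrank_ker_vertexCoboundary_le (G := G)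
    have h5 : finrank (ZMod 2) (LinearMap.range M.transpose.mulVecLin) =
        finrank (ZMod 2) (LinearMap.range M.mulVecLin) := Matrix.rank_transpose M
    have h6 := P.euler
    simp only [finrank_fintype_fun_eq_card, ← Nat.card_eq_fintype_card] at h1 h2 h3
    omega
  have heq := Submodule.eq_of_le_of_finrank_le hle hrank
  have hw : (fun e => w (o e)) ∈ LinearMap.ker M.mulVecLin := by
    rw [LinearMap.mem_ker]
    ext f
    rw [hM w hsymm, hface]
    rfl
  rw [← heq] at hw
  obtain ⟨s, hs⟩ := hw
  refine ⟨s, fun d => ?_⟩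
  have h1 := congrFun hs ⟨d.edge, d.edge_mem⟩
  rw [vertexCoboundary_edge] at h1
  rw [h1]
  rcases (SimpleGraph.dart_edge_eq_iff _ _).1 (ho ⟨d.edge, d.edge_mem⟩) with h3 | h3
  · rw [h3]
  · rw [h3, hsymm]

end PlaneEmbedding

/-! ### Absence of bridges -/

namespace SimpleGraph

variable {V : Type*} {G : SimpleGraph V}

instance Dart.finite [Finite V] : Finite G.Dart := Finite.of_injective _ Dart.toProd_injective

open Classical in
theorem IsRegularOfDegree.card_dart_fst [Fintype G.Dart] [G.LocallyFinite] {k : ℕ}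
    (h : G.IsRegularOfDegree k) (v : V) :
    (Finset.univ.filter fun d : G.Dart => d.fst = v).card = k := by
  rw [← h v, ← G.card_neighborSet_eq_degree, ← Finset.card_univ,
    ← Finset.card_image_of_injective _ (G.dartOfNeighborSet_injective v)]
  congr 1
  ext d
  simp only [Finset.mem_filter, Finset.mem_univ, true_and, Finset.mem_image]
  constructor
  · rintro rfl
    exact ⟨⟨d.snd, d.adj⟩, rfl⟩
  · rintro ⟨u, rfl⟩
    rfl

/-- A regular bipartite graph of degree at least two has no bridge: an edge is not the only one
between a set of vertices and its complement. -/
theorem IsRegularOfDegree.exists_dart_ne [Finite V] [G.LocallyFinite] {k : ℕ}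
    (h : G.IsRegularOfDegree k) (hk : 2 ≤ k) (hbip : G.IsBipartite) (s : V → Prop)
    (d₀ : G.Dart) (hd₀ : s d₀.fst ∧ ¬ s d₀.snd) :
    ∃ d : G.Dart, d ≠ d₀ ∧ d ≠ d₀.symm ∧ ¬ (s d.fst ↔ s d.snd) := by
  classical
  by_contra! hcon
  have := Fintype.ofFinite V
  have := Fintype.ofFinite G.Dart
  obtain ⟨b⟩ := hbip
  -- Summing the signs `ε` over the darts that leave the set gives a multiple of `k`. Edges inside
  -- the set cancel, so only `d₀` contributes, and `k` divides `±1`.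
  let ε : V → ℤ := fun v => if b v = 0 then 1 else -1
  have hε : ∀ d : G.Dart, ε d.snd = -ε d.fst := by
    intro d
    have h1 : b d.fst ≠ b d.snd := b.valid d.adj
    have h2 : ∀ x y : Fin 2, x ≠ y →
        (if y = 0 then (1 : ℤ) else -1) = -(if x = 0 then 1 else -1) := by decide
    exact h2 _ _ h1
  let i : V → ℤ := fun v => if s v then 1 else 0
  have hsum : ∑ d : G.Dart, i d.fst * ε d.fst = k * ∑ v, i v * ε v := by
    rw [← Finset.sum_fiberwise (g := fun d : G.Dart => d.fst), Finset.mul_sum]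
    refine Finset.sum_congr rfl fun v _ => ?_
    rw [Finset.sum_congr rfl (g := fun _ => i v * ε v)
      (fun d hd => by rw [(Finset.mem_filter.1 hd).2]), Finset.sum_const, h.card_dart_fst,
      nsmul_eq_mul]
  have hsum' : ∑ d : G.Dart, i d.snd * ε d.snd = ∑ d : G.Dart, i d.fst * ε d.fst :=
    Dart.symm_involutive.bijective.sum_comp (fun d : G.Dart => i d.fst * ε d.fst)
  have hpair : ∑ d : G.Dart, (i d.fst * ε d.fst + i d.snd * ε d.snd) =
      ∑ d ∈ {d₀, d₀.symm}, (i d.fst * ε d.fst + i d.snd * ε d.snd) := by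
    symm
    refine Finset.sum_subset (Finset.subset_univ _) fun d _ hd => ?_
    simp only [Finset.mem_insert, Finset.mem_singleton, not_or] at hd
    have h1 := hcon d hd.1 hd.2
    have h2 : i d.fst = i d.snd := by simp [i, h1]
    rw [hε, h2]
    ring
  have h1 : i d₀.fst = 1 := if_pos hd₀.1
  have h2 : i d₀.snd = 0 := if_neg hd₀.2
  rw [Finset.sum_add_distrib, hsum', hsum, Finset.sum_pair d₀.symm_ne.symm] at hpair
  change _ = i d₀.fst * ε d₀.fst + i d₀.snd * ε d₀.snd +
    (i d₀.snd * ε d₀.snd + i d₀.fst * ε d₀.fst) at hpair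
  rw [h1, h2] at hpair
  have h3 : (k : ℤ) ∣ ε d₀.fst := ⟨∑ v, i v * ε v, by linarith⟩
  have h4 : IsUnit (ε d₀.fst) := by
    by_cases hb : b d₀.fst = 0 <;> simp [ε, hb]
  have h5 := Int.isUnit_iff.1 (isUnit_of_dvd_unit h3 h4)
  omega

end SimpleGraph

open SimpleGraph

namespace PlaneEmbedding

variable {V F : Type*} {G : SimpleGraph V}

open Classical in
/-- In a plane cubic bipartite graph the two sides of an edge belong to different faces. -/
theorem face_symm_ne [Finite V] [Finite F] [G.LocallyFinite] (P : PlaneEmbedding G F)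
    (hbip : G.IsBipartite) (hcubic : G.IsRegularOfDegree 3) (d₀ : G.Dart) :
    P.face d₀ ≠ P.face d₀.symm := by
  intro heq
  have := Fintype.ofFinite G.Dart
  -- With the same face on both sides, the indicator of the edge has sum zero on every face. It is
  -- then a coboundary, so the edge alone forms a cut.
  obtain ⟨s, hs⟩ := P.exists_potential
    (fun d => (if d = d₀ then 1 else 0) + (if d = d₀.symm then 1 else 0))
    (fun d => by
      have h1 : d.symm = d₀ ↔ d = d₀.symm := Dart.symm_involutive.eq_iff
      have h2 : d.symm = d₀.symm ↔ d = d₀ := Dart.symm_involutive.injective.eq_iff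
      simp only [h1, h2]
      exact add_comm _ _)
    (fun f => by
      simp only [Finset.sum_add_distrib, Finset.sum_ite_eq', Finset.mem_filter, Finset.mem_univ,
        true_and, heq]
      exact CharTwo.add_self_eq_zero _)
  have h0 := hs d₀
  rw [if_pos rfl, if_neg d₀.symm_ne.symm, add_zero] at h0
  have key : ∀ d : G.Dart, s d.fst ≠ s d.snd → d = d₀ ∨ d = d₀.symm := by
    intro d hd
    by_contra hcon
    rw [not_or] at hcon
    have := hs d
    rw [if_neg hcon.1, if_neg hcon.2, add_zero] at this
    exact hd (CharTwo.add_eq_zero.1 this)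
  have hx : ∀ x y : ZMod 2, x + y = 1 → x = x ∧ ¬ y = x := by decide
  obtain ⟨d, hd1, hd2, hd3⟩ := hcubic.exists_dart_ne (by norm_num) hbip
    (fun v => s v = s d₀.fst) d₀ (hx _ _ h0)
  rcases key d (fun h => hd3 (by rw [h])) with h | h
  · exact hd1 h
  · exact hd2 h

end PlaneEmbedding

/-! ### Rotation and face colors at a cubic vertex -/

namespace FacedMap

variable {V F : Type*} {G : SimpleGraph V}

theorem minimalPeriod_rot [Finite V] [G.LocallyFinite] (M : FacedMap G F) {k : ℕ}
    (h : G.IsRegularOfDegree k) (d : G.Dart) : minimalPeriod M.rot d = k := by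
  classical
  have := Fintype.ofFinite G.Dart
  have hfst : ∀ i : ℕ, (M.rot^[i] d).fst = d.fst := by
    intro i
    induction i with
    | zero => rfl
    | succ i ih => rw [iterate_succ_apply', M.rot_fst, ih]
  rw [← h.card_dart_fst d.fst, ← Finset.card_range (minimalPeriod M.rot d),
    ← Finset.card_image_of_injOn (s := Finset.range (minimalPeriod M.rot d))
      (f := fun i => M.rot^[i] d)
      (by simpa using iterate_injOn_Iio_minimalPeriod (f := M.rot) (x := d))]
  congr 1
  ext d'
  simp only [Finset.mem_image, Finset.mem_range, Finset.mem_filter, Finset.mem_univ, true_and]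
  constructor
  · rintro ⟨i, -, rfl⟩
    exact hfst i
  · intro hd'
    exact (M.rot_sameCycle d d' hd'.symm).exists_iterate_eq

theorem rot_rot_rot [Finite V] [G.LocallyFinite] (M : FacedMap G F)
    (h : G.IsRegularOfDegree 3) (d : G.Dart) : M.rot (M.rot (M.rot d)) = d := by
  have := iterate_minimalPeriod (f := M.rot) (x := d)
  rwa [M.minimalPeriod_rot h] at this

theorem eq_or_eq_rot [Finite V] [G.LocallyFinite] (M : FacedMap G F)
    (h : G.IsRegularOfDegree 3) {d d' : G.Dart} (hd : d.fst = d'.fst) :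
    d' = d ∨ d' = M.rot d ∨ d' = M.rot (M.rot d) := by
  obtain ⟨i, hi, rfl⟩ := (M.rot_sameCycle d d' hd).exists_iterate_eq
  rw [M.minimalPeriod_rot h] at hi
  interval_cases i
  · exact Or.inl rfl
  · exact Or.inr (Or.inl rfl)
  · exact Or.inr (Or.inr rfl)

end FacedMap

theorem FaceColor.eq_or_eq_or_eq {x y z : FaceColor} (hxy : x ≠ y) (hyz : y ≠ z) (hzx : z ≠ x)
    (c : FaceColor) : c = x ∨ c = y ∨ c = z := by
  cases x <;> cases y <;> cases z <;> cases c <;> simp_all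

namespace FacedMap

variable {V F : Type*} {G : SimpleGraph V} (M : FacedMap G F)

/-- The color of the face to the left of a dart. -/
def dartColor (col : F → FaceColor) (d : G.Dart) : FaceColor := col (M.face d)

variable {col : F → FaceColor}

theorem dartColor_rot (d : G.Dart) : M.dartColor col (M.rot d) = M.dartColor col d.symm :=
  congrArg col (M.face_rot_symm d.symm)

theorem dartColor_rot_symm (d : G.Dart) : M.dartColor col (M.rot d.symm) = M.dartColor col d :=
  congrArg col (M.face_rot_symm d)

theorem dartColor_rot_ne (hcol : ∀ d, M.dartColor col d ≠ M.dartColor col d.symm)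
    (d : G.Dart) : M.dartColor col (M.rot d) ≠ M.dartColor col d := by
  rw [dartColor_rot]
  exact (hcol d).symm

theorem dartColor_rot_rot_ne [Finite V] [G.LocallyFinite]
    (hcol : ∀ d, M.dartColor col d ≠ M.dartColor col d.symm) (h : G.IsRegularOfDegree 3)
    (d : G.Dart) : M.dartColor col (M.rot (M.rot d)) ≠ M.dartColor col d := by
  have := M.dartColor_rot_ne hcol (M.rot (M.rot d))
  rw [M.rot_rot_rot h] at this
  exact this.symm

theorem dartColor_cases [Finite V] [G.LocallyFinite]
    (hcol : ∀ d, M.dartColor col d ≠ M.dartColor col d.symm) (h : G.IsRegularOfDegree 3)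
    (d : G.Dart) (c : FaceColor) : c = M.dartColor col d ∨ c = M.dartColor col (M.rot d) ∨
      c = M.dartColor col (M.rot (M.rot d)) :=
  FaceColor.eq_or_eq_or_eq (M.dartColor_rot_ne hcol d).symm
    (M.dartColor_rot_ne hcol (M.rot d)).symm (M.dartColor_rot_rot_ne hcol h d) c

theorem dart_eq_of_color_eq [Finite V] [G.LocallyFinite]
    (hcol : ∀ d, M.dartColor col d ≠ M.dartColor col d.symm) (h : G.IsRegularOfDegree 3)
    {d d' : G.Dart} (hd : d.fst = d'.fst) (hc : M.dartColor col d = M.dartColor col d') :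
    d' = d := by
  rcases M.eq_or_eq_rot h hd with rfl | rfl | rfl
  · rfl
  · exact absurd hc.symm (M.dartColor_rot_ne hcol d)
  · exact absurd hc.symm (M.dartColor_rot_rot_ne hcol h d)

theorem exists_dart_color [Finite V] [G.LocallyFinite]
    (hcol : ∀ d, M.dartColor col d ≠ M.dartColor col d.symm) (h : G.IsRegularOfDegree 3) (v : V)
    (c : FaceColor) : ∃ d : G.Dart, d.fst = v ∧ M.dartColor col d = c := by
  classical
  have := Fintype.ofFinite G.Dart
  have h3 := h.card_dart_fst v
  obtain ⟨d, hd⟩ := Finset.card_pos.1 (by omega :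
    0 < (Finset.univ.filter fun d : G.Dart => d.fst = v).card)
  replace hd := (Finset.mem_filter.1 hd).2
  rcases M.dartColor_cases hcol h d c with hc | hc | hc
  · exact ⟨d, hd, hc.symm⟩
  · exact ⟨M.rot d, by rw [M.rot_fst, hd], hc.symm⟩
  · exact ⟨M.rot (M.rot d), by rw [M.rot_fst, M.rot_fst, hd], hc.symm⟩

open Classical in
/-- Along the boundary of a face of color different from `c`, the edges that have a face of color
`c` on the other side alternate with the others. So if the size of the face is divisible by four,
then each sort of edges is even in number. -/
theorem sum_face_ne_color [Finite V] [G.LocallyFinite] [Fintype G.Dart]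
    (hcol : ∀ d, M.dartColor col d ≠ M.dartColor col d.symm)
    (h : G.IsRegularOfDegree 3) (c : FaceColor) (f : F) (hf : col f ≠ c)
    (hsize : 4 ∣ M.faceSize f) :
    ∑ d with M.face d = f, (if M.dartColor col d.symm ≠ c then 1 else 0 : ZMod 2) = 0 := by
  have hcard : M.faceSize f = (Finset.univ.filter fun d => M.face d = f).card := by
    rw [faceSize, Nat.card_eq_fintype_card, Fintype.card_subtype]
  -- The count is made over the integers because it yields twice the wanted sum.
  let x : G.Dart → ℤ := fun d => if M.dartColor col d.symm ≠ c then 1 else 0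
  have hx : ∀ d ∈ Finset.univ.filter fun d => M.face d = f, x (M.rot d.symm) + x d = 1 := by
    intro d hd
    have hdf : M.dartColor col d ≠ c := by
      rw [dartColor, (Finset.mem_filter.1 hd).2]
      exact hf
    -- The faces at the end of `d` are `f`, the one across `d` and the one across the next boundary
    -- edge; exactly one of the last two has color `c`.
    have h1 := M.dartColor_cases hcol h d.symm c
    have h2 := M.dartColor_rot_rot_ne hcol h d.symm
    rw [M.dartColor_rot_symm] at h1
    simp only [x, ← M.dartColor_rot]
    rw [M.dartColor_rot (d := d)]
    rcases h1 with h1 | h1 | h1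
    · rw [← h1] at h2 ⊢
      simp [h2]
    · exact absurd h1.symm hdf
    · rw [← h1] at h2 ⊢
      simp [h2.symm]
  have hsum := Finset.sum_congr rfl hx
  rw [Finset.sum_add_distrib, M.sum_face_rot_symm, Finset.sum_const, ← hcard] at hsum
  obtain ⟨m, hm⟩ := hsize
  rw [hm] at hsum
  have hval : ∑ d with M.face d = f, x d = 2 * m := by
    simp at hsum
    linarith
  have := congrArg (Int.cast : ℤ → ZMod 2) hval
  simp only [x, Int.cast_sum, Int.cast_ite, Int.cast_one, Int.cast_zero] at this
  rw [this]
  push_cast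
  rw [show (2 : ZMod 2) = 0 from rfl, zero_mul]

end FacedMap

/-! ### Assembling the six-coloring -/

/-- A permutation `n` and a map `μ` that together reach all neighbors give a distance-two coloring
with six colors from a three-coloring `c` and a two-coloring `t`. -/
theorem isDistanceTwoColoring_of_maps {V : Type*} {G : SimpleGraph V} {n μ : V → V}
    (hn : Injective n) (hnbr : ∀ v u, G.Adj v u → u = n v ∨ u = μ v ∨ n u = v)
    {c : V → Fin 3} {t : V → Fin 2} (htn : ∀ v, t (n v) ≠ t v) (htμ : ∀ v, t (μ v) = t v)
    (hcn : ∀ v, c (n (n v)) ≠ c v) (hcμ : ∀ v, c (μ v) ≠ c v) :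
    IsDistanceTwoColoring G 6 fun v => finProdFinEquiv (c v, t v) := by
  intro v x hx y hy hxy
  have hxy' := finProdFinEquiv.injective hxy
  have hcxy : c x = c y := congrArg Prod.fst hxy'
  have htxy : t x = t y := congrArg Prod.snd hxy'
  clear hxy hxy'
  have hx' : x = v ∨ x = n v ∨ x = μ v ∨ n x = v := by
    rcases hx with hx | hx
    · exact Or.inl hx
    · exact Or.inr (hnbr v x hx)
  have hy' : y = v ∨ y = n v ∨ y = μ v ∨ n y = v := by
    rcases hy with hy | hy
    · exact Or.inl hy
    · exact Or.inr (hnbr v y hy)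
  have h1 := htn v
  have h2 := htμ v
  have h3 := hcμ v
  -- `t` separates `v`, `μ v` from `n v`, `n⁻¹ v`; `c` separates within each pair.
  rcases hx' with rfl | rfl | rfl | hx' <;> rcases hy' with rfl | rfl | rfl | hy'
  all_goals first | rfl | grind

theorem theorem2p4 {V F : Type*} [Finite V] [Finite F] (G : SimpleGraph V) [G.LocallyFinite]
    (hbip : G.IsBipartite) (hcubic : G.IsRegularOfDegree 3)
    (P : PlaneEmbedding G F) (col : P.dual.Coloring FaceColor)
    (hblue : ∀ f : F, col f = FaceColor.blue → 4 ∣ P.faceSize f)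
    (hgreen : ∀ f : F, col f = FaceColor.green → 4 ∣ P.faceSize f) :
    ∃ c : V → Fin 6, IsDistanceTwoColoring G 6 c := by
  classical
  have := Fintype.ofFinite G.Dart
  let γ : G.Dart → FaceColor := P.dartColor col
  have hγ : ∀ d, γ d ≠ γ d.symm := by
    intro d
    -- `col` distinguishes only different faces, so bridges must be excluded.
    refine col.valid ?_
    rw [FacedMap.dual, SimpleGraph.fromRel_adj]
    exact ⟨P.face_symm_ne hbip hcubic d, Or.inl ⟨d, rfl, rfl⟩⟩
  -- a potential that changes exactly along the edges between a blue and a green face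
  obtain ⟨s, hs⟩ := P.exists_potential
    (fun d => if γ d ≠ .red ∧ γ d.symm ≠ .red then 1 else 0)
    (fun d => by
      rw [Dart.symm_symm]
      simp only [and_comm])
    (fun f => by
      by_cases hf : col f = .red
      · refine Finset.sum_eq_zero fun d hd => if_neg fun h => h.1 ?_
        rw [← hf, ← (Finset.mem_filter.1 hd).2]
        rfl
      · have hsize : 4 ∣ P.faceSize f := by
          cases hc : col f with
          | red => exact absurd hc hf
          | blue => exact hblue f hc
          | green => exact hgreen f hc
        refine Eq.trans ?_ (P.sum_face_ne_color hγ hcubic .red f hf hsize)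
        refine Finset.sum_congr rfl fun d hd => ?_
        have : γ d ≠ .red := by
          rw [← (Finset.mem_filter.1 hd).2] at hf
          exact hf
        simp only [this, ne_eq, not_false_eq_true, true_and]
        rfl)
  -- the dart that leaves a vertex with the red face on its left, and the vertex it leads to
  choose r hrfst hrcol using fun v => P.exists_dart_color hγ hcubic v .red
  have hr_eq : ∀ {d : G.Dart}, γ d = .red → d = r d.fst := fun {d} hd =>
    P.dart_eq_of_color_eq hγ hcubic (hrfst _) ((hrcol _).trans hd.symm)
  let n : V → V := fun v => (r v).snd
  have hrn : ∀ v, r (n v) = P.rot (r v).symm := by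
    intro v
    rw [hr_eq ((P.dartColor_rot_symm (r v)).trans (hrcol v)), P.rot_fst]
    rfl
  have hn_inj : Injective n := by
    intro u v huv
    have h1 : P.rot (r u).symm = P.rot (r v).symm := by rw [← hrn, ← hrn, huv]
    have h2 := Dart.symm_involutive.injective (P.rot.injective h1)
    rw [← hrfst u, h2, hrfst]
  let σ₀ : Equiv.Perm V := Equiv.ofBijective n (Finite.injective_iff_bijective.1 hn_inj)
  let σ : Equiv.Perm V := σ₀ * σ₀
  have hσ_apply : ∀ v, σ v = n (n v) := fun v => rfl
  have hadj_n : ∀ v, G.Adj v (n v) := by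
    intro v
    have := (r v).adj
    rwa [hrfst] at this
  have hsn : ∀ v, s (n v) = s v := by
    intro v
    have := hs (r v)
    rw [if_neg fun h => h.1 (hrcol v), hrfst] at this
    exact (CharTwo.add_eq_zero.1 this).symm
  -- If `n (n v) = v`, simplicity makes `r (n v)` the reversal of `r v`; the rotation would then fix
  -- a dart, although it changes the face color.
  have hσ : ∀ v, σ v ≠ v := by
    intro v hv
    have h1 : r (n v) = (r v).symm := by
      apply Dart.ext
      exact Prod.ext (hrfst _) (hv.trans (hrfst v).symm)
    rw [hrn] at h1
    exact P.dartColor_rot_ne hγ _ (congrArg γ h1)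
  -- the partner of a vertex along the edge between a blue and a green face
  let m : V → G.Dart := fun v => P.rot (r v)
  let μ : V → V := fun v => (m v).snd
  have hmfst : ∀ v, (m v).fst = v := fun v => (P.rot_fst _).trans (hrfst v)
  have hm_eq : ∀ d : G.Dart, γ d ≠ .red → γ d.symm ≠ .red → m d.fst = d := by
    intro d h1 h2
    have h3 : γ (P.rot (P.rot d)) = .red := by
      rcases P.dartColor_cases hγ hcubic d .red with h | h | h
      · exact absurd h.symm h1
      · rw [P.dartColor_rot] at h
        exact absurd h.symm h2
      · exact h.symm
    have h4 := hr_eq h3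
    rw [P.rot_fst, P.rot_fst] at h4
    change P.rot (r d.fst) = d
    rw [← h4, P.rot_rot_rot hcubic]
  have hm1 : ∀ v, γ (m v) ≠ .red := by
    intro v
    rw [← hrcol v]
    exact P.dartColor_rot_ne hγ _
  have hm2 : ∀ v, γ (m v).symm ≠ .red := by
    intro v
    rw [← hrcol v, show γ (m v).symm = γ (P.rot (m v)) from (P.dartColor_rot _).symm]
    exact P.dartColor_rot_rot_ne hγ hcubic _
  have hμ : Involutive μ := by
    intro v
    have h1 : m (μ v) = (m v).symm :=
      hm_eq (m v).symm (hm2 v) (by rw [Dart.symm_symm]; exact hm1 v)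
    change (m (μ v)).snd = v
    rw [h1]
    exact hmfst v
  have hadj_μ : ∀ v, G.Adj v (μ v) := by
    intro v
    have := (m v).adj
    rwa [hmfst] at this
  have hsμ : ∀ v, s v + s (μ v) = 1 := by
    intro v
    have := hs (m v)
    rwa [if_pos ⟨hm1 v, hm2 v⟩, hmfst] at this
  have hloop : ∀ v, ¬ σ.SameCycle (μ v) v := by
    intro v hv
    have hiter : ∀ (i : ℕ) u, s (σ^[i] u) = s u := by
      intro i
      induction i with
      | zero => exact fun u => rfl
      | succ i ih =>
        intro u
        rw [iterate_succ_apply, ih, hσ_apply, hsn, hsn]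
    obtain ⟨i, -, hi⟩ := hv.exists_iterate_eq
    have h1 := hiter i (μ v)
    have h2 := hsμ v
    rw [hi] at h1
    rw [← h1, CharTwo.add_self_eq_zero] at h2
    exact zero_ne_one h2
  obtain ⟨c, hc⟩ := Equiv.Perm.exists_three_coloring hμ hloop hσ
  obtain ⟨b⟩ := hbip
  let β : V → ZMod 2 := fun v => b v
  -- Along a red face only `β` changes; along a blue-green edge both terms change and cancel.
  let t : V → ZMod 2 := fun v => s v + β v
  have hb : ∀ {u v : V}, G.Adj u v → β u + β v = 1 := by
    intro u v huv
    have h2 : ∀ x y : ZMod 2, x ≠ y → x + y = 1 := by decide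
    exact h2 _ _ (b.valid huv)
  have htn : ∀ v, t (n v) ≠ t v := by
    intro v h
    have h1 := hb (hadj_n v)
    simp only [t, hsn, add_right_inj] at h
    rw [h, CharTwo.add_self_eq_zero] at h1
    exact zero_ne_one h1
  have htμ : ∀ v, t (μ v) = t v := by
    intro v
    have h : ∀ a a' e e' : ZMod 2, a + a' = 1 → e + e' = 1 → a' + e' = a + e := by decide
    exact h _ _ _ _ (hsμ v) (hb (hadj_μ v))
  have hnbr : ∀ v u, G.Adj v u → u = n v ∨ u = μ v ∨ n u = v := by
    intro v u hvu
    rcases P.eq_or_eq_rot hcubic (d := r v) (d' := ⟨(v, u), hvu⟩) (hrfst v) with h | h | h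
    · exact Or.inl (congrArg (fun d : G.Dart => d.snd) h)
    · exact Or.inr (Or.inl (congrArg (fun d : G.Dart => d.snd) h))
    · right; right
      have h1 : γ (Dart.symm ⟨(v, u), hvu⟩) = .red := by
        rw [← hrcol v]
        refine (P.dartColor_rot _).symm.trans ?_
        rw [h, P.rot_rot_rot hcubic]
      have h2 := hr_eq h1
      exact congrArg (fun d : G.Dart => d.snd) h2.symm
  exact ⟨_, isDistanceTwoColoring_of_maps hn_inj hnbr (t := t) htn htμ (fun u => (hc u).1)
    fun u => (hc u).2⟩
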